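/- Let $n,m\ge 0$ be integers, $V\subseteq\mathbb{R}^n$ open, $f:\mathbb{R}^n\times\mathbb{R}^m\to\mathbb{R}^n$ of class $C^\infty$, $x_0\in\mathbb{R}^n$ and $T>0$. The trajectory associated with a control $u\in L^\infty([0,T];\mathbb{R}^m)$ is the absolutely continuous curve $x_u:[0,T]\to V$, if it exists on all of $[0,T]$, such that $x_u(0)=x_0$ and $\dot x_u(t)=f(x_u(t),u(t))$ for almost every $t\in[0,T]$. The input–output map in time $T$ is $E_T(u)=x_u(T)$, defined on the (open) set of those $u\in L^\infty([0,T];\mathbb{R}^m)$ whose trajectory exists on $[0,T]$. Such a control $u$ is called singular on $[0,T]$ if the Fréchet differential $dE_T(u):L^\infty([0,T];\mathbb{R}^m)\to\mathbb{R}^n$ is not surjective. Let $$H(x,p,u)=\langle p,f(x,u)\rangle ,\qquad x,p\in\mathbb{R}^n,\ u\in\mathbb{R}^m,$$ where $\langle\cdot,\cdot\rangle$ is the usual scalar product of $\mathbb{R}^n$. Let $u$ be a singular control and let $x=x_u$ be its trajectory on $[0,T]$. Then there is a continuous, indeed absolutely continuous, row vector $p:[0,T]\to\mathbb{R}^n\setminus\{0\}$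 such that for almost every $t\in[0,T]$ $$\dot x(t)=\frac{\partial H}{\partial p}(x(t),p(t),u(t)),\qquad \dot p(t)=-\frac{\partial H}{\partial x}(x(t),p(t),u(t)),\qquad \frac{\partial H}{\partial u}(x(t),p(t),u(t))=0 .$$ -/

import Mathlib

open MeasureTheory Set
open scoped ENNReal ContDiff

/-- `L^∞([0,T]; ℝ^m)`: (classes of) bounded measurable controls on `[0,T]`, with the
essential supremum norm. -/
abbrev Control (m : ℕ) (T : ℝ) : Type :=
  Lp (EuclideanSpace ℝ (Fin m)) ∞ (volume.restrict (Icc (0 : ℝ) T))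

/-- `x` is the trajectory on `[0,T]`, in the open set `V`, of the control system `ẋ = f(x,u)`
started at `x₀` and associated with the control `u`: an absolutely continuous curve in `V` with
`x(0) = x₀` that solves the differential equation almost everywhere on `[0,T]`. -/
structure IsTrajectory {n m : ℕ} (V : Set (EuclideanSpace ℝ (Fin n)))
    (f : EuclideanSpace ℝ (Fin n) → EuclideanSpace ℝ (Fin m) → EuclideanSpace ℝ (Fin n))
    (x₀ : EuclideanSpace ℝ (Fin n)) (T : ℝ) (u : Control m T)
    (x : ℝ → EuclideanSpace ℝ (Fin n)) : Prop where
  absCont : AbsolutelyContinuousOnInterval x 0 T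
  mem : ∀ t ∈ Icc (0 : ℝ) T, x t ∈ V
  initial : x 0 = x₀
  ode : ∀ᵐ t ∂(volume.restrict (Icc (0 : ℝ) T)), HasDerivAt x (f (x t) (u t)) t

open Classical in
/-- The input-output map `E_T : u ↦ x_u(T)` in time `T` of the system started at `x₀`. It is
meaningful on the set of those controls whose trajectory is defined on all of `[0,T]`; for smooth
`f` trajectories are unique and this set is open in `L^∞`, so that the (irrelevant) value `x₀`
given to the other controls does not affect the differential of `E_T` at a control of this set. -/
noncomputable def inputOutputMap {n m : ℕ} (V : Set (EuclideanSpace ℝ (Fin n)))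
    (f : EuclideanSpace ℝ (Fin n) → EuclideanSpace ℝ (Fin m) → EuclideanSpace ℝ (Fin n))
    (x₀ : EuclideanSpace ℝ (Fin n)) (T : ℝ) (u : Control m T) : EuclideanSpace ℝ (Fin n) :=
  if h : ∃ x, IsTrajectory V f x₀ T u x then h.choose T else x₀

/-- The control `u` is singular on `[0,T]`: its trajectory is defined on `[0,T]` and the Fréchet
differential at `u` of the input-output map, a continuous linear map `L^∞([0,T]; ℝ^m) → ℝ^n`,
is not surjective. -/
def IsSingularControl {n m : ℕ} (V : Set (EuclideanSpace ℝ (Fin n)))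
    (f : EuclideanSpace ℝ (Fin n) → EuclideanSpace ℝ (Fin m) → EuclideanSpace ℝ (Fin n))
    (x₀ : EuclideanSpace ℝ (Fin n)) (T : ℝ) (u : Control m T) : Prop :=
  (∃ x, IsTrajectory V f x₀ T u x) ∧
    ¬ Function.Surjective (fderiv ℝ (inputOutputMap V f x₀ T) u)

/-- The Hamiltonian `H(x,p,u) = ⟨p, f(x,u)⟩` of the control system `ẋ = f(x,u)`. -/
noncomputable def hamiltonian {n m : ℕ}
    (f : EuclideanSpace ℝ (Fin n) → EuclideanSpace ℝ (Fin m) → EuclideanSpace ℝ (Fin n))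
    (x p : EuclideanSpace ℝ (Fin n)) (u : EuclideanSpace ℝ (Fin m)) : ℝ :=
  inner ℝ p (f x u)

/-! A trajectory is a solution ξ of ξ = x₀ + ∫₀ᵗ f(ξ, u) ds, that is, a zero of Φ(v, ξ) = ξ - x₀ -
∫₀ᵗ f(ξ, v) ds on L^∞ × C([0,T]). The map Φ is strictly differentiable
(`hasStrictFDerivAt_superpositionIntegral`), and its partial derivative in ξ is 1 - K for a Volterra
operator K with bounded kernel, hence invertible (`isUnit_one_sub_volterraOp`). The implicit
function theorem, with uniqueness of trajectories, then shows that E_T is differentiable at u with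
dE_T(u) v = ζ(T), where ζ' = Aζ + Bv, ζ(0) = 0, A = ∂f/∂x and B = ∂f/∂u along the trajectory
(`hasFDerivAt_inputOutputMap`).

If dE_T(u) is not onto, some ψ ≠ 0 is orthogonal to its range. Let p solve p' = -Aᵀp with p(T) = ψ.
Since ⟨p, ζ⟩' = ⟨p, Bv⟩ almost everywhere, 0 = ⟨ψ, ζ(T)⟩ = ∫ ⟨p, Bv⟩ for every v, and the choice v =
Bᵀp forces Bᵀp = 0 almost everywhere (`ae_adjoint_apply_eq_zero`). These are the adjoint equation
and ∂H/∂u = 0. By Grönwall a zero of p would propagate to p(T) = ψ, so p never vanishes. -/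

/-! ### Strict differentiability, uniform on compact sets -/

section UniformStrictDerivative

open Metric in
/-- A `C^1` function is strictly differentiable uniformly along a compact set. -/
theorem IsCompact.exists_forall_norm_sub_sub_fderiv_le {X E : Type*}
    [NormedAddCommGroup X] [NormedSpace ℝ X] [NormedAddCommGroup E] [NormedSpace ℝ E]
    {K : Set X} (hK : IsCompact K) {g : X → E} (hg : ContDiff ℝ 1 g) {ε : ℝ} (hε : 0 < ε) :
    ∃ δ > 0, ∀ z ∈ K, ∀ z₁ ∈ ball z δ, ∀ z₂ ∈ ball z δ,
      ‖g z₁ - g z₂ - fderiv ℝ g z (z₁ - z₂)‖ ≤ ε * ‖z₁ - z₂‖ := by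
  have hc : Continuous (fderiv ℝ g) := hg.continuous_fderiv one_ne_zero
  -- Only one of the two points compared has to lie in `K`, so the balls around points of `K` may
  -- leave `K`.
  obtain ⟨δ, hδ, h⟩ := Metric.mem_uniformity_dist.1
    (hK.uniformContinuousAt_of_continuousAt (fderiv ℝ g) (fun a _ => hc.continuousAt)
      (Metric.dist_mem_uniformity hε))
  refine ⟨δ, hδ, fun z hz z₁ h₁ z₂ h₂ => ?_⟩
  refine (convex_ball z δ).norm_image_sub_le_of_norm_fderiv_le'
    (fun x _ => (hg.differentiable one_ne_zero) x) (fun x hx => ?_) h₂ h₁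
  have := h (a := z) (b := x) (by rw [dist_comm]; exact hx) hz
  rw [← dist_eq_norm, dist_comm]
  exact le_of_lt this

end UniformStrictDerivative

/-! ### Grönwall's inequality -/

section Gronwall

/-- Integral form of Grönwall's inequality with zero initial value. -/
theorem eq_zero_of_le_mul_integral {a b C : ℝ} {g : ℝ → ℝ} (hg : ContinuousOn g (Icc a b))
    (h0 : ∀ t ∈ Icc a b, 0 ≤ g t) (h : ∀ t ∈ Icc a b, g t ≤ C * ∫ s in a..t, g s) :
    ∀ t ∈ Icc a b, g t = 0 := by
  intro t ht
  have hab : a ≤ b := ht.1.trans ht.2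
  have hu : uIcc a b = Icc a b := uIcc_of_le hab
  have hF : ∀ t ∈ Icc a b, ∫ s in a..t, g s = 0 := by
    -- The hypothesis is the differential inequality |F'| ≤ C |F| for the primitive F of `g` with
    -- F(a) = 0.
    refine eq_zero_of_abs_deriv_le_mul_abs_self_of_eq_zero_right (f' := g) (K := C) ?_ ?_ (by simp)
      ?_
    · have := intervalIntegral.continuousOn_primitive_interval (f := g) (μ := volume) (a := a)
        (b := b) (by rw [hu]; exact hg.integrableOn_Icc)
      rwa [hu] at this
    · intro x hx
      have hx' : x ∈ Icc a b := Ico_subset_Icc_self hx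
      refine intervalIntegral.integral_hasDerivWithinAt_right (t := Ioi x) ?_ ?_ ?_
      · refine (ContinuousOn.mono hg ?_).intervalIntegrable
        rw [uIcc_of_le hx.1]
        exact Icc_subset_Icc_right hx.2.le
      · exact ⟨Ioo x b, Ioo_mem_nhdsGT hx.2,
          (hg.mono fun y hy => ⟨hx.1.trans hy.1.le, hy.2.le⟩).aestronglyMeasurable
            measurableSet_Ioo⟩
      · refine ((hg x hx').mono_of_mem_nhdsWithin ?_)
        exact Filter.mem_of_superset (Ioo_mem_nhdsGT hx.2)
          fun y hy => ⟨hx.1.trans hy.1.le, hy.2.le⟩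
    · intro x hx
      have hx' : x ∈ Icc a b := Ico_subset_Icc_self hx
      have hI : 0 ≤ ∫ s in a..x, g s := intervalIntegral.integral_nonneg hx.1
        fun s hs => h0 s ⟨hs.1, hs.2.trans hx'.2⟩
      rw [Real.norm_of_nonneg (h0 x hx'), Real.norm_of_nonneg hI]
      exact h x hx'
  have := h t ht
  rw [hF t ht, mul_zero] at this
  exact le_antisymm this (h0 t ht)

end Gronwall

/-! ### Primitives of essentially bounded functions and absolute continuity -/

section Primitive

variable {E : Type*} [NormedAddCommGroup E] {T : ℝ}

theorem intervalIntegrable_of_integrableOn_Icc {g : ℝ → E}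
    (hg : IntegrableOn g (Icc 0 T) volume) {s t : ℝ}
    (hs : s ∈ Icc 0 T) (ht : t ∈ Icc 0 T) : IntervalIntegrable g volume s t := by
  rw [intervalIntegrable_iff]
  exact hg.mono_set (uIoc_subset_uIcc.trans (uIcc_subset_Icc hs ht))

theorem ae_mem_uIoc_of_ae_restrict_Icc {P : ℝ → Prop}
    (hP : ∀ᵐ s ∂(volume.restrict (Icc 0 T)), P s) {s t : ℝ} (hs : s ∈ Icc 0 T)
    (ht : t ∈ Icc 0 T) : ∀ᵐ r, r ∈ uIoc s t → P r := by
  rw [ae_restrict_iff' measurableSet_Icc] at hP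
  filter_upwards [hP] with r hr hrs
  exact hr (uIcc_subset_Icc hs ht (uIoc_subset_uIcc hrs))

variable [NormedSpace ℝ E]

theorem norm_integral_le_of_ae_restrict_Icc {g : ℝ → E} {C : ℝ}
    (hC : ∀ᵐ s ∂(volume.restrict (Icc 0 T)), ‖g s‖ ≤ C) {s t : ℝ} (hs : s ∈ Icc 0 T)
    (ht : t ∈ Icc 0 T) : ‖∫ r in s..t, g r‖ ≤ C * |t - s| :=
  intervalIntegral.norm_integral_le_of_norm_le_const_ae (ae_mem_uIoc_of_ae_restrict_Icc hC hs ht)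

/-- The primitive vanishing at `0` of an integrable function on `[0, T]`. -/
noncomputable def primitiveOn (g : ℝ → E) (hg : IntegrableOn g (Icc 0 T) volume) :
    C(Icc (0 : ℝ) T, E) where
  toFun t := ∫ s in (0 : ℝ)..t, g s
  continuous_toFun := by
    rcases le_or_gt 0 T with hT | hT
    · have := intervalIntegral.continuousOn_primitive_interval (f := g) (μ := volume) (a := 0)
        (b := T) (by rwa [uIcc_of_le hT])
      rw [uIcc_of_le hT] at this
      exact continuousOn_iff_continuous_domRestrict.1 this
    · have : IsEmpty (Icc 0 T) := by simp [Icc_eq_empty hT.not_ge]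
      exact continuous_of_const fun x => this.elim x

theorem primitiveOn_apply (g : ℝ → E) (hg : IntegrableOn g (Icc 0 T) volume) (t : Icc (0 : ℝ) T) :
    primitiveOn g hg t = ∫ s in (0 : ℝ)..t, g s := rfl

theorem norm_primitiveOn_le (hT : 0 ≤ T) {g : ℝ → E} (hg : IntegrableOn g (Icc 0 T) volume) {C : ℝ}
    (hC0 : 0 ≤ C) (hC : ∀ᵐ s ∂(volume.restrict (Icc 0 T)), ‖g s‖ ≤ C) :
    ‖primitiveOn g hg‖ ≤ C * T := by
  refine (ContinuousMap.norm_le _ (by positivity)).2 fun t => ?_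
  refine (norm_integral_le_of_ae_restrict_Icc hC (left_mem_Icc.2 hT) t.2).trans ?_
  rw [sub_zero, abs_of_nonneg t.2.1]
  exact mul_le_mul_of_nonneg_left t.2.2 hC0

theorem primitiveOn_add {g h : ℝ → E} (hg : IntegrableOn g (Icc 0 T) volume)
    (hh : IntegrableOn h (Icc 0 T) volume)
    (hgh : IntegrableOn (fun s => g s + h s) (Icc 0 T) volume) :
    primitiveOn (fun s => g s + h s) hgh = primitiveOn g hg + primitiveOn h hh := by
  ext t
  have h0 : (0 : ℝ) ∈ Icc 0 T := ⟨le_rfl, t.2.1.trans t.2.2⟩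
  simp only [primitiveOn_apply, ContinuousMap.add_apply]
  exact intervalIntegral.integral_add (intervalIntegrable_of_integrableOn_Icc hg h0 t.2)
    (intervalIntegrable_of_integrableOn_Icc hh h0 t.2)

theorem primitiveOn_sub {g h : ℝ → E} (hg : IntegrableOn g (Icc 0 T) volume)
    (hh : IntegrableOn h (Icc 0 T) volume)
    (hgh : IntegrableOn (fun s => g s - h s) (Icc 0 T) volume) :
    primitiveOn (fun s => g s - h s) hgh = primitiveOn g hg - primitiveOn h hh := by
  ext t
  have h0 : (0 : ℝ) ∈ Icc 0 T := ⟨le_rfl, t.2.1.trans t.2.2⟩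
  simp only [primitiveOn_apply, ContinuousMap.sub_apply]
  exact intervalIntegral.integral_sub (intervalIntegrable_of_integrableOn_Icc hg h0 t.2)
    (intervalIntegrable_of_integrableOn_Icc hh h0 t.2)

theorem primitiveOn_smul (c : ℝ) {g : ℝ → E} (hg : IntegrableOn g (Icc 0 T) volume)
    (hcg : IntegrableOn (fun s => c • g s) (Icc 0 T) volume) :
    primitiveOn (fun s => c • g s) hcg = c • primitiveOn g hg := by
  ext t
  simp [primitiveOn_apply]

theorem primitiveOn_congr {g h : ℝ → E} (hg : IntegrableOn g (Icc 0 T) volume)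
    (hh : IntegrableOn h (Icc 0 T) volume) (H : g =ᵐ[volume.restrict (Icc 0 T)] h) :
    primitiveOn g hg = primitiveOn h hh := by
  ext t
  have h0 : (0 : ℝ) ∈ Icc 0 T := ⟨le_rfl, t.2.1.trans t.2.2⟩
  exact intervalIntegral.integral_congr_ae (ae_mem_uIoc_of_ae_restrict_Icc H h0 t.2)

/-- A function with an essentially bounded integrand as derivative is Lipschitz. -/
theorem lipschitzOnWith_add_integral {g : ℝ → E} {C : NNReal} (hg : IntegrableOn g (Icc 0 T) volume)
    (hC : ∀ᵐ s ∂(volume.restrict (Icc 0 T)), ‖g s‖ ≤ C) {a : ℝ} (ha : a ∈ Icc 0 T) (c : E) :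
    LipschitzOnWith C (fun t => c + ∫ s in a..t, g s) (Icc 0 T) := by
  refine LipschitzOnWith.of_dist_le_mul fun s hs t ht => ?_
  rw [dist_eq_norm, add_sub_add_left_eq_sub, intervalIntegral.integral_interval_sub_left
    (intervalIntegrable_of_integrableOn_Icc hg ha hs)
    (intervalIntegrable_of_integrableOn_Icc hg ha ht)]
  exact norm_integral_le_of_ae_restrict_Icc hC ht hs

theorem absolutelyContinuousOnInterval_add_integral (hT : 0 ≤ T) {g : ℝ → E} {C : ℝ}
    (hg : IntegrableOn g (Icc 0 T) volume)
    (hC : ∀ᵐ s ∂(volume.restrict (Icc 0 T)), ‖g s‖ ≤ C) {a : ℝ} (ha : a ∈ Icc 0 T) (c : E) :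
    AbsolutelyContinuousOnInterval (fun t => c + ∫ s in a..t, g s) 0 T := by
  refine LipschitzOnWith.absolutelyContinuousOnInterval (K := C.toNNReal) ?_
  rw [uIcc_of_le hT]
  exact lipschitzOnWith_add_integral hg (hC.mono fun s hs => hs.trans (Real.le_coe_toNNReal C)) ha c

theorem ae_hasDerivAt_add_integral [CompleteSpace E] (hT : 0 ≤ T) {g : ℝ → E}
    (hg : IntegrableOn g (Icc 0 T) volume) {a : ℝ} (ha : a ∈ Icc 0 T) (c : E) :
    ∀ᵐ t ∂(volume.restrict (Icc 0 T)), HasDerivAt (fun t => c + ∫ s in a..t, g s) (g t) t := by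
  rw [ae_restrict_iff' measurableSet_Icc]
  filter_upwards [IntervalIntegrable.ae_hasDerivAt_integral
    (intervalIntegrable_of_integrableOn_Icc hg (left_mem_Icc.2 hT) (right_mem_Icc.2 hT))]
    with t ht htT
  rw [uIcc_of_le hT] at ht
  exact (ht htT a ha).const_add c

/-- An absolutely continuous function is the integral of its almost everywhere derivative, provided
the latter is essentially bounded. -/
theorem AbsolutelyContinuousOnInterval.eq_add_integral [CompleteSpace E] (hT : 0 ≤ T)
    {x g : ℝ → E} {C : ℝ} (hx : AbsolutelyContinuousOnInterval x 0 T)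
    (hg : IntegrableOn g (Icc 0 T) volume) (hC : ∀ᵐ s ∂(volume.restrict (Icc 0 T)), ‖g s‖ ≤ C)
    (hd : ∀ᵐ t ∂(volume.restrict (Icc 0 T)), HasDerivAt x (g t) t) {t : ℝ} (ht : t ∈ Icc 0 T) :
    x t = x 0 + ∫ s in (0 : ℝ)..t, g s := by
  have h0 : (0 : ℝ) ∈ Icc 0 T := left_mem_Icc.2 hT
  have hy := ae_hasDerivAt_add_integral hT hg h0 (x 0)
  -- The difference of the two sides is absolutely continuous with zero derivative almost
  -- everywhere, hence constant.
  obtain ⟨c, hc⟩ := (hx.sub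
    (absolutelyContinuousOnInterval_add_integral hT hg hC h0 (x 0))).const_of_ae_hasDerivAt_zero (by
      rw [uIcc_of_le hT, ← ae_restrict_iff' measurableSet_Icc]
      filter_upwards [hd, hy] with s h₁ h₂
      simpa using h₁.sub h₂)
  rw [uIcc_of_le hT] at hc
  have h₁ := hc 0 h0
  have h₂ := hc t ht
  simp only [Pi.sub_apply, intervalIntegral.integral_same, add_zero, sub_self] at h₁ h₂
  rw [← h₁] at h₂
  exact sub_eq_zero.1 h₂

end Primitive

/-! ### Volterra operators with bounded kernel -/

section Volterra

variable {E F : Type*} [NormedAddCommGroup E] [NormedAddCommGroup F] {T : ℝ}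

theorem continuous_IccExtend_coe (hT : 0 ≤ T) (ξ : C(Icc (0 : ℝ) T, E)) :
    Continuous (IccExtend hT ξ) :=
  ξ.continuous.Icc_extend'

theorem norm_IccExtend_le (hT : 0 ≤ T) (ξ : C(Icc (0 : ℝ) T, E)) (s : ℝ) :
    ‖IccExtend hT ξ s‖ ≤ ‖ξ‖ :=
  ξ.norm_coe_le_norm _

theorem memLp_top_IccExtend (hT : 0 ≤ T) (ξ : C(Icc (0 : ℝ) T, E)) :
    MemLp (IccExtend hT ξ) ∞ (volume.restrict (Icc 0 T)) :=
  memLp_top_of_bound (continuous_IccExtend_coe hT ξ).aestronglyMeasurable ‖ξ‖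
    (Filter.Eventually.of_forall (norm_IccExtend_le hT ξ))

theorem MeasureTheory.Lp.ae_norm_le_norm_top {α : Type*} [MeasurableSpace α] {μ : Measure α}
    (v : Lp E ∞ μ) : ∀ᵐ s ∂μ, ‖v s‖ ≤ ‖v‖ := by
  have := ae_le_lpNorm_exponent_top (Lp.memLp v)
  rwa [← toReal_eLpNorm (Lp.aestronglyMeasurable v), ← Lp.norm_def] at this

theorem MeasureTheory.MemLp.integrableOn_Icc {g : ℝ → E}
    (hg : MemLp g ∞ (volume.restrict (Icc 0 T))) : IntegrableOn g (Icc 0 T) volume :=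
  hg.integrable le_top

variable [NormedSpace ℝ E] [NormedSpace ℝ F]

theorem MeasureTheory.MemLp.clm_apply_top {α : Type*} [MeasurableSpace α] {μ : Measure α}
    {A : α → E →L[ℝ] F} {v : α → E} (hA : MemLp A ∞ μ) (hv : MemLp v ∞ μ) :
    MemLp (fun s => A s (v s)) ∞ μ := by
  refine memLp_top_of_bound (C := lpNorm A ∞ μ * lpNorm v ∞ μ) ?_ ?_
  · exact isBoundedBilinearMap_apply.continuous.comp_aestronglyMeasurable
      (hA.aestronglyMeasurable.prodMk hv.aestronglyMeasurable)
  · filter_upwards [ae_le_lpNorm_exponent_top hA, ae_le_lpNorm_exponent_top hv] with s h₁ h₂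
    exact (A s).le_of_opNorm_le_of_le h₁ h₂

/-- The operator `v ↦ ∫₀ᵗ B(s) v(s) ds` on essentially bounded functions. -/
noncomputable def integralOp (hT : 0 ≤ T) (B : ℝ → E →L[ℝ] F)
    (hB : MemLp B ∞ (volume.restrict (Icc 0 T))) :
    Lp E ∞ (volume.restrict (Icc (0 : ℝ) T)) →L[ℝ] C(Icc (0 : ℝ) T, F) :=
  LinearMap.mkContinuous
    { toFun := fun v => primitiveOn (fun s => B s (v s))
        (hB.clm_apply_top (Lp.memLp v)).integrableOn_Icc
      map_add' := fun v w => by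
        rw [← primitiveOn_add _ _ ((hB.clm_apply_top (Lp.memLp v)).integrableOn_Icc.add
          (hB.clm_apply_top (Lp.memLp w)).integrableOn_Icc)]
        refine primitiveOn_congr _ _ ?_
        filter_upwards [Lp.coeFn_add v w] with s hs
        rw [hs, Pi.add_apply, map_add]
      map_smul' := fun c v => by
        rw [RingHom.id_apply, ← primitiveOn_smul c _
          ((hB.clm_apply_top (Lp.memLp v)).integrableOn_Icc.smul c)]
        refine primitiveOn_congr _ _ ?_
        filter_upwards [Lp.coeFn_smul c v] with s hs
        rw [hs, Pi.smul_apply, map_smul] }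
    (lpNorm B ∞ (volume.restrict (Icc 0 T)) * T) (fun v => by
      have := norm_primitiveOn_le hT (hB.clm_apply_top (Lp.memLp v)).integrableOn_Icc
        (C := lpNorm B ∞ (volume.restrict (Icc 0 T)) * ‖v‖)
        (mul_nonneg lpNorm_nonneg (norm_nonneg _)) (by
          filter_upwards [ae_le_lpNorm_exponent_top hB, Lp.ae_norm_le_norm_top v] with s h₁ h₂
          exact (B s).le_of_opNorm_le_of_le h₁ h₂)
      calc _ ≤ _ := this
        _ = _ := by ring)

theorem integralOp_apply (hT : 0 ≤ T) {B : ℝ → E →L[ℝ] F}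
    (hB : MemLp B ∞ (volume.restrict (Icc 0 T)))
    (v : Lp E ∞ (volume.restrict (Icc (0 : ℝ) T))) :
    integralOp hT B hB v = primitiveOn (fun s => B s (v s))
      (hB.clm_apply_top (Lp.memLp v)).integrableOn_Icc := rfl

/-- The Volterra operator `ξ ↦ ∫₀ᵗ A(s) ξ(s) ds` on continuous curves. -/
noncomputable def volterraOp (hT : 0 ≤ T) (A : ℝ → E →L[ℝ] F)
    (hA : MemLp A ∞ (volume.restrict (Icc 0 T))) :
    C(Icc (0 : ℝ) T, E) →L[ℝ] C(Icc (0 : ℝ) T, F) :=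
  LinearMap.mkContinuous
    { toFun := fun ξ => primitiveOn (fun s => A s (IccExtend hT ξ s))
        (hA.clm_apply_top (memLp_top_IccExtend hT ξ)).integrableOn_Icc
      map_add' := fun ξ η => by
        rw [← primitiveOn_add _ _
          ((hA.clm_apply_top (memLp_top_IccExtend hT ξ)).integrableOn_Icc.add
          (hA.clm_apply_top (memLp_top_IccExtend hT η)).integrableOn_Icc)]
        refine primitiveOn_congr _ _ (Filter.Eventually.of_forall fun s => ?_)
        simp [IccExtend_apply]
      map_smul' := fun c ξ => by
        rw [RingHom.id_apply, ← primitiveOn_smul c _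
          ((hA.clm_apply_top (memLp_top_IccExtend hT ξ)).integrableOn_Icc.smul c)]
        refine primitiveOn_congr _ _ (Filter.Eventually.of_forall fun s => ?_)
        simp [IccExtend_apply] }
    (lpNorm A ∞ (volume.restrict (Icc 0 T)) * T) (fun ξ => by
      have := norm_primitiveOn_le hT (hA.clm_apply_top (memLp_top_IccExtend hT ξ)).integrableOn_Icc
        (C := lpNorm A ∞ (volume.restrict (Icc 0 T)) * ‖ξ‖)
        (mul_nonneg lpNorm_nonneg (norm_nonneg _)) (by
          filter_upwards [ae_le_lpNorm_exponent_top hA] with s h₁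
          exact (A s).le_of_opNorm_le_of_le h₁ (norm_IccExtend_le hT ξ s))
      calc _ ≤ _ := this
        _ = _ := by ring)

theorem volterraOp_apply (hT : 0 ≤ T) {A : ℝ → E →L[ℝ] F}
    (hA : MemLp A ∞ (volume.restrict (Icc 0 T))) (ξ : C(Icc (0 : ℝ) T, E)) :
    volterraOp hT A hA ξ = primitiveOn (fun s => A s (IccExtend hT ξ s))
      (hA.clm_apply_top (memLp_top_IccExtend hT ξ)).integrableOn_Icc := rfl

/-- Integrating C (Cs)^k / k! over [0, t] gives (Ct)^(k+1) / (k+1)!. The factorial appears because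
the bound carried through the induction depends on `t` and is not just a supremum over [0,T]. -/
theorem norm_volterraOp_pow_apply_le (hT : 0 ≤ T) {A : ℝ → E →L[ℝ] E}
    (hA : MemLp A ∞ (volume.restrict (Icc 0 T))) (k : ℕ) (ξ : C(Icc (0 : ℝ) T, E))
    (t : Icc (0 : ℝ) T) :
    ‖(volterraOp hT A hA ^ k) ξ t‖ ≤
      (lpNorm A ∞ (volume.restrict (Icc 0 T)) * t) ^ k / k.factorial * ‖ξ‖ := by
  set C := lpNorm A ∞ (volume.restrict (Icc 0 T)) with hC
  induction k generalizing t with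
  | zero => simpa using ξ.norm_coe_le_norm t
  | succ k ih =>
    set η := (volterraOp hT A hA ^ k) ξ
    have : (volterraOp hT A hA ^ (k + 1)) ξ = volterraOp hT A hA η := by
      rw [pow_succ']; rfl
    rw [this, volterraOp_apply, primitiveOn_apply]
    have h0 : (0 : ℝ) ∈ Icc 0 T := left_mem_Icc.2 hT
    have hle : ∀ᵐ s, s ∈ Ioc 0 (t : ℝ) →
        ‖A s (IccExtend hT η s)‖ ≤ C * ((C * s) ^ k / k.factorial * ‖ξ‖) := by
      have hb := ae_mem_uIoc_of_ae_restrict_Icc (ae_le_lpNorm_exponent_top hA) h0 t.2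
      rw [uIoc_of_le t.2.1] at hb
      filter_upwards [hb] with s hs hst
      refine (A s).le_of_opNorm_le_of_le (hs hst) ?_
      have hsT : s ∈ Icc 0 T := ⟨hst.1.le, hst.2.trans t.2.2⟩
      rw [IccExtend_of_mem _ _ hsT]
      exact ih ⟨s, hsT⟩
    refine (intervalIntegral.norm_integral_le_of_norm_le t.2.1 hle
      (Continuous.intervalIntegrable (by fun_prop) _ _)).trans (le_of_eq ?_)
    have : ∀ s : ℝ, C * ((C * s) ^ k / k.factorial * ‖ξ‖) =
        (C ^ (k + 1) / k.factorial * ‖ξ‖) * s ^ k := fun s => by ring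
    simp_rw [this]
    rw [intervalIntegral.integral_const_mul, integral_pow, Nat.factorial_succ]
    push_cast
    have : ((k.factorial : ℕ) : ℝ) ≠ 0 := by positivity
    field_simp
    simp [mul_pow]
    ring

/-- With K the Volterra operator, the factorial bound gives ‖K^k‖ < 1 for some k, however large T
and the kernel are. Then 1 - K^k is invertible by the Neumann series, and so is its factor 1 - K,
which commutes with the cofactor ∑_{i<k} K^i. -/
theorem isUnit_one_sub_volterraOp [CompleteSpace E] (hT : 0 ≤ T) {A : ℝ → E →L[ℝ] E}
    (hA : MemLp A ∞ (volume.restrict (Icc 0 T))) : IsUnit (1 - volterraOp hT A hA) := by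
  set C := lpNorm A ∞ (volume.restrict (Icc 0 T)) with hC
  have hC0 : 0 ≤ C := lpNorm_nonneg
  obtain ⟨k, hk⟩ := ((FloorSemiring.tendsto_pow_div_factorial_atTop (C * T)).eventually
    (gt_mem_nhds one_pos)).exists
  have hn : ‖volterraOp hT A hA ^ k‖ < 1 := by
    refine (ContinuousLinearMap.opNorm_le_bound _ (by positivity) fun ξ => ?_).trans_lt hk
    refine (ContinuousMap.norm_le _ (by positivity)).2 fun t => ?_
    refine (norm_volterraOp_pow_apply_le hT hA k ξ t).trans ?_
    have ht := t.2
    gcongr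
    · exact mul_nonneg hC0 ht.1
    · exact ht.2
  have hu := isUnit_one_sub_of_norm_lt_one (R := C(Icc (0 : ℝ) T, E) →L[ℝ] C(Icc (0 : ℝ) T, E)) hn
  rw [← mul_neg_geom_sum] at hu
  refine (Commute.isUnit_mul_iff ?_).1 hu |>.1
  rw [Commute, SemiconjBy, mul_neg_geom_sum, geom_sum_mul_neg]

end Volterra

/-! ### Differentiability of the superposition operator on L^∞ × C -/

section Superposition

variable {E U F : Type*} [NormedAddCommGroup E] [NormedAddCommGroup U] [NormedAddCommGroup F]
  {T : ℝ}

/-- The pair formed by a continuous curve (extended by constants) and a control. -/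
noncomputable def statePath (hT : 0 ≤ T) (v : ℝ → U) (ξ : C(Icc (0 : ℝ) T, E)) (s : ℝ) : E × U :=
  (IccExtend hT ξ s, v s)

/-- Almost all values of `z` lie in one closed ball, compact by properness, on which `h` is bounded;
no growth condition on `h` is needed. -/
theorem MeasureTheory.MemLp.comp_continuous_top {α Z : Type*} [MeasurableSpace α] {μ : Measure α}
    [NormedAddCommGroup Z] [ProperSpace Z] {z : α → Z} (hz : MemLp z ∞ μ) {h : Z → F}
    (hh : Continuous h) : MemLp (fun s => h (z s)) ∞ μ := by
  obtain ⟨C, hC⟩ := (isCompact_closedBall (0 : Z) (lpNorm z ∞ μ)).exists_bound_of_continuousOn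
    hh.continuousOn
  refine memLp_top_of_bound (hh.comp_aestronglyMeasurable hz.aestronglyMeasurable) C ?_
  filter_upwards [ae_le_lpNorm_exponent_top hz] with s hs
  exact hC _ (mem_closedBall_zero_iff.2 hs)

theorem memLp_top_statePath (hT : 0 ≤ T) {v : ℝ → U}
    (hv : MemLp v ∞ (volume.restrict (Icc 0 T))) (ξ : C(Icc (0 : ℝ) T, E)) :
    MemLp (statePath hT v ξ) ∞ (volume.restrict (Icc 0 T)) := by
  refine memLp_top_of_bound (C := max ‖ξ‖ (lpNorm v ∞ (volume.restrict (Icc 0 T))))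
    ((continuous_IccExtend_coe hT ξ).aestronglyMeasurable.prodMk hv.aestronglyMeasurable) ?_
  filter_upwards [ae_le_lpNorm_exponent_top hv] with s hs
  exact max_le_max (norm_IccExtend_le hT ξ s) hs

/-- With sup norms on both factors, closeness in the product space is closeness at almost every
time. This allows the pointwise strict differentiability estimate to be integrated. -/
theorem ae_norm_statePath_sub_le (hT : 0 ≤ T)
    (q r : Lp U ∞ (volume.restrict (Icc (0 : ℝ) T)) × C(Icc (0 : ℝ) T, E)) :
    ∀ᵐ s ∂(volume.restrict (Icc (0 : ℝ) T)),
      ‖statePath hT q.1 q.2 s - statePath hT r.1 r.2 s‖ ≤ ‖q - r‖ := by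
  filter_upwards [Lp.coeFn_sub q.1 r.1, Lp.ae_norm_le_norm_top (q.1 - r.1)] with s h₁ h₂
  rw [h₁] at h₂
  rw [Prod.norm_def (x := q - r), max_comm]
  exact max_le_max (norm_IccExtend_le hT (q.2 - r.2) s) h₂

variable [NormedSpace ℝ E] [NormedSpace ℝ U] [NormedSpace ℝ F] [ProperSpace E] [ProperSpace U]

/-- The operator `(v, ξ) ↦ ∫₀ᵗ g(ξ(s), v(s)) ds`. -/
noncomputable def superpositionIntegral (hT : 0 ≤ T) {g : E × U → F} (hg : Continuous g)
    (q : Lp U ∞ (volume.restrict (Icc (0 : ℝ) T)) × C(Icc (0 : ℝ) T, E)) :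
    C(Icc (0 : ℝ) T, F) :=
  primitiveOn (fun s => g (statePath hT q.1 q.2 s))
    ((memLp_top_statePath hT (Lp.memLp q.1) q.2).comp_continuous_top hg).integrableOn_Icc

theorem memLp_top_fderiv_statePath (hT : 0 ≤ T) {v : ℝ → U}
    (hv : MemLp v ∞ (volume.restrict (Icc 0 T))) (ξ : C(Icc (0 : ℝ) T, E)) {g : E × U → F}
    (hg : ContDiff ℝ 1 g) :
    MemLp (fun s => fderiv ℝ g (statePath hT v ξ s)) ∞ (volume.restrict (Icc 0 T)) :=
  (memLp_top_statePath hT hv ξ).comp_continuous_top (hg.continuous_fderiv one_ne_zero)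

theorem memLp_top_fderiv_inl_statePath (hT : 0 ≤ T) {v : ℝ → U}
    (hv : MemLp v ∞ (volume.restrict (Icc 0 T))) (ξ : C(Icc (0 : ℝ) T, E)) {g : E × U → F}
    (hg : ContDiff ℝ 1 g) :
    MemLp (fun s => fderiv ℝ g (statePath hT v ξ s) ∘L .inl ℝ E U) ∞
      (volume.restrict (Icc 0 T)) :=
  (memLp_top_statePath hT hv ξ).comp_continuous_top
    (h := fun z => fderiv ℝ g z ∘L .inl ℝ E U)
    ((hg.continuous_fderiv one_ne_zero).clm_comp continuous_const)

theorem memLp_top_fderiv_inr_statePath (hT : 0 ≤ T) {v : ℝ → U}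
    (hv : MemLp v ∞ (volume.restrict (Icc 0 T))) (ξ : C(Icc (0 : ℝ) T, E)) {g : E × U → F}
    (hg : ContDiff ℝ 1 g) :
    MemLp (fun s => fderiv ℝ g (statePath hT v ξ s) ∘L .inr ℝ E U) ∞
      (volume.restrict (Icc 0 T)) :=
  (memLp_top_statePath hT hv ξ).comp_continuous_top
    (h := fun z => fderiv ℝ g z ∘L .inr ℝ E U)
    ((hg.continuous_fderiv one_ne_zero).clm_comp continuous_const)

/-- The operator `(v, ξ) ↦ ∫₀ᵗ g(ξ(s), v(s)) ds` is strictly differentiable. -/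
theorem hasStrictFDerivAt_superpositionIntegral (hT : 0 ≤ T) {g : E × U → F}
    (hg : ContDiff ℝ 1 g)
    (q : Lp U ∞ (volume.restrict (Icc (0 : ℝ) T)) × C(Icc (0 : ℝ) T, E)) :
    HasStrictFDerivAt (superpositionIntegral hT hg.continuous)
      (integralOp hT _ (memLp_top_fderiv_inr_statePath hT (Lp.memLp q.1) q.2 hg) ∘L .fst ℝ _ _ +
        volterraOp hT _ (memLp_top_fderiv_inl_statePath hT (Lp.memLp q.1) q.2 hg) ∘L .snd ℝ _ _)
      q := by
  refine .of_isLittleO (Asymptotics.isLittleO_iff.2 fun c hc => ?_)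
  have hz := memLp_top_statePath hT (Lp.memLp q.1) q.2
  set D : ℝ → E × U →L[ℝ] F := fun s => fderiv ℝ g (statePath hT q.1 q.2 s)
  -- Integration over [0,T] costs a factor T, and c T / (T + 1) ≤ c; the denominator T + 1 also
  -- covers T = 0.
  obtain ⟨δ, hδ, H⟩ := (isCompact_closedBall (0 : E × U)
    (lpNorm (statePath hT q.1 q.2) ∞ (volume.restrict (Icc 0 T)))
    ).exists_forall_norm_sub_sub_fderiv_le
      hg (ε := c / (T + 1)) (by positivity)
  rw [nhds_prod_eq]
  filter_upwards [Filter.prod_mem_prod (Metric.ball_mem_nhds q hδ) (Metric.ball_mem_nhds q hδ)]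
  rintro ⟨q₁, q₂⟩ ⟨h₁, h₂⟩
  rw [Metric.mem_ball, dist_eq_norm] at h₁ h₂
  have hi (r : Lp U ∞ (volume.restrict (Icc (0 : ℝ) T)) × C(Icc (0 : ℝ) T, E)) :
      MemLp (fun s => g (statePath hT r.1 r.2 s)) ∞ (volume.restrict (Icc 0 T)) :=
    (memLp_top_statePath hT (Lp.memLp r.1) r.2).comp_continuous_top hg.continuous
  have hi₁₂ : MemLp (fun s => g (statePath hT q₁.1 q₁.2 s) - g (statePath hT q₂.1 q₂.2 s)) ∞
      (volume.restrict (Icc 0 T)) := (hi q₁).sub (hi q₂)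
  have hD := memLp_top_fderiv_statePath hT (Lp.memLp q.1) q.2 hg
  have hDz : MemLp (fun s => D s (statePath hT (q₁ - q₂).1 (q₁ - q₂).2 s)) ∞
      (volume.restrict (Icc 0 T)) :=
    hD.clm_apply_top (memLp_top_statePath hT (Lp.memLp (q₁ - q₂).1) (q₁ - q₂).2)
  have hA := (memLp_top_fderiv_inl_statePath hT (Lp.memLp q.1) q.2 hg).clm_apply_top
    (memLp_top_IccExtend hT (q₁ - q₂).2)
  have hB := (memLp_top_fderiv_inr_statePath hT (Lp.memLp q.1) q.2 hg).clm_apply_top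
    (Lp.memLp (q₁ - q₂).1)
  -- The remainder of the operator is the primitive of the pointwise remainder of `g`, the
  -- derivative being split into its state and control parts.
  have key : superpositionIntegral hT hg.continuous q₁ - superpositionIntegral hT hg.continuous q₂ -
      (integralOp hT _ (memLp_top_fderiv_inr_statePath hT (Lp.memLp q.1) q.2 hg) (q₁ - q₂).1 +
        volterraOp hT _ (memLp_top_fderiv_inl_statePath hT (Lp.memLp q.1) q.2 hg) (q₁ - q₂).2) =
      primitiveOn (fun s => g (statePath hT q₁.1 q₁.2 s) - g (statePath hT q₂.1 q₂.2 s) -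
        D s (statePath hT (q₁ - q₂).1 (q₁ - q₂).2 s))
        (hi₁₂.sub hDz).integrableOn_Icc := by
    rw [primitiveOn_sub hi₁₂.integrableOn_Icc hDz.integrableOn_Icc,
      superpositionIntegral, superpositionIntegral]
    congr 1
    · exact (primitiveOn_sub (hi q₁).integrableOn_Icc (hi q₂).integrableOn_Icc _).symm
    · rw [integralOp_apply, volterraOp_apply, ← primitiveOn_add hB.integrableOn_Icc
        hA.integrableOn_Icc (hB.add hA).integrableOn_Icc]
      refine primitiveOn_congr _ _ (Filter.Eventually.of_forall fun s => ?_)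
      simp only [D, statePath, ContinuousLinearMap.comp_apply, ContinuousLinearMap.inr_apply,
        ContinuousLinearMap.inl_apply, ← map_add]
      simp
  have hfin := norm_primitiveOn_le hT (hi₁₂.sub hDz).integrableOn_Icc
    (C := c / (T + 1) * ‖q₁ - q₂‖) (by positivity) (by
      filter_upwards [ae_le_lpNorm_exponent_top hz, ae_norm_statePath_sub_le hT q₁ q,
        ae_norm_statePath_sub_le hT q₂ q, ae_norm_statePath_sub_le hT q₁ q₂,
        Lp.coeFn_sub q₁.1 q₂.1] with s hs hs₁ hs₂ hs₁₂ hsub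
      have := H _ (mem_closedBall_zero_iff.2 hs) _
        (by rw [Metric.mem_ball, dist_eq_norm]; exact hs₁.trans_lt h₁) _
        (by rw [Metric.mem_ball, dist_eq_norm]; exact hs₂.trans_lt h₂)
      have hst : statePath hT (q₁ - q₂).1 (q₁ - q₂).2 s =
          statePath hT q₁.1 q₁.2 s - statePath hT q₂.1 q₂.2 s := Prod.ext rfl hsub
      rw [Pi.sub_apply, hst]
      exact this.trans (by gcongr))
  refine (le_of_eq (congrArg norm key)).trans (hfin.trans ?_)
  rw [mul_right_comm]
  refine mul_le_mul_of_nonneg_right ?_ (norm_nonneg _)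
  rw [div_mul_eq_mul_div, div_le_iff₀ (by positivity)]
  nlinarith

/-- Two integral solutions of the same control system with the same control coincide. -/
theorem eq_of_eq_add_superpositionIntegral (hT : 0 ≤ T) {g : E × U → E} (hg : ContDiff ℝ 1 g)
    {v : Lp U ∞ (volume.restrict (Icc (0 : ℝ) T))} {c : C(Icc (0 : ℝ) T, E)}
    {ξ η : C(Icc (0 : ℝ) T, E)} (hξ : ξ = c + superpositionIntegral hT hg.continuous (v, ξ))
    (hη : η = c + superpositionIntegral hT hg.continuous (v, η)) : ξ = η := by
  -- The ball of radius `R` contains both state-control paths at almost every time; by convexity a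
  -- bound of the derivative there is a Lipschitz constant for `g`.
  set R := max (max ‖ξ‖ ‖η‖) ‖v‖
  obtain ⟨C, hC⟩ := (isCompact_closedBall (0 : E × U) R).exists_bound_of_continuousOn
    (hg.continuous_fderiv one_ne_zero).continuousOn
  have hc : Continuous fun s => ‖IccExtend hT ξ s - IccExtend hT η s‖ :=
    ((continuous_IccExtend_coe hT ξ).sub (continuous_IccExtend_coe hT η)).norm
  have h0 : (0 : ℝ) ∈ Icc 0 T := left_mem_Icc.2 hT
  have hi (ζ : C(Icc (0 : ℝ) T, E)) :
      IntegrableOn (fun s => g (statePath hT v ζ s)) (Icc 0 T) volume :=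
    ((memLp_top_statePath hT (Lp.memLp v) ζ).comp_continuous_top hg.continuous).integrableOn_Icc
  have hlip : ∀ᵐ s ∂(volume.restrict (Icc (0 : ℝ) T)),
      ‖g (statePath hT v ξ s) - g (statePath hT v η s)‖ ≤
        C * ‖IccExtend hT ξ s - IccExtend hT η s‖ := by
    filter_upwards [Lp.ae_norm_le_norm_top v] with s hs
    have := (convex_closedBall (0 : E × U) R).norm_image_sub_le_of_norm_fderiv_le (𝕜 := ℝ)
      (fun x _ => (hg.differentiable one_ne_zero) x) hC (x := statePath hT v η s)
      (y := statePath hT v ξ s)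
      (mem_closedBall_zero_iff.2 (max_le_max ((norm_IccExtend_le hT η s).trans
        (le_max_right _ _)) hs))
      (mem_closedBall_zero_iff.2 (max_le_max ((norm_IccExtend_le hT ξ s).trans
        (le_max_left _ _)) hs))
    simpa [statePath, Prod.norm_def] using this
  have hz := eq_zero_of_le_mul_integral (a := 0) (b := T) (C := C) hc.continuousOn
    (fun t _ => norm_nonneg _) (fun t ht => by
      have hξt : ξ ⟨t, ht⟩ = c ⟨t, ht⟩ + ∫ s in (0 : ℝ)..t, g (statePath hT v ξ s) :=
        congrArg (fun ζ : C(Icc (0 : ℝ) T, E) => ζ ⟨t, ht⟩) hξ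
      have hηt : η ⟨t, ht⟩ = c ⟨t, ht⟩ + ∫ s in (0 : ℝ)..t, g (statePath hT v η s) :=
        congrArg (fun ζ : C(Icc (0 : ℝ) T, E) => ζ ⟨t, ht⟩) hη
      rw [IccExtend_of_mem _ _ ht, IccExtend_of_mem _ _ ht, hξt, hηt, add_sub_add_left_eq_sub,
        ← intervalIntegral.integral_sub
        (intervalIntegrable_of_integrableOn_Icc (hi ξ) h0 ht)
        (intervalIntegrable_of_integrableOn_Icc (hi η) h0 ht),
        ← intervalIntegral.integral_const_mul]
      refine intervalIntegral.norm_integral_le_of_norm_le ht.1 ?_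
        ((continuous_const.mul hc).intervalIntegrable _ _)
      have := ae_mem_uIoc_of_ae_restrict_Icc hlip h0 ht
      rwa [uIoc_of_le ht.1] at this)
  ext t
  have := hz t t.2
  rw [IccExtend_of_mem _ _ t.2, IccExtend_of_mem _ _ t.2] at this
  exact sub_eq_zero.1 (norm_eq_zero.1 this)

end Superposition

/-! ### Trajectories as solutions of an integral equation; the differential of E_T -/

section Trajectory

variable {n m : ℕ} {V : Set (EuclideanSpace ℝ (Fin n))}
  {f : EuclideanSpace ℝ (Fin n) → EuclideanSpace ℝ (Fin m) → EuclideanSpace ℝ (Fin n)}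
  {x₀ : EuclideanSpace ℝ (Fin n)} {T : ℝ} {u : Control m T}

/-- A trajectory is a solution of the integral equation. -/
theorem IsTrajectory.exists_eq_add_superpositionIntegral (hT : 0 ≤ T)
    (hf : Continuous fun z : EuclideanSpace ℝ (Fin n) × EuclideanSpace ℝ (Fin m) => f z.1 z.2)
    {x : ℝ → EuclideanSpace ℝ (Fin n)} (hx : IsTrajectory V f x₀ T u x) :
    ∃ ξ : C(Icc (0 : ℝ) T, EuclideanSpace ℝ (Fin n)), (∀ t : Icc (0 : ℝ) T, ξ t = x t) ∧
      ξ = ContinuousMap.const _ x₀ + superpositionIntegral hT hf (u, ξ) := by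
  have hc : ContinuousOn x (Icc 0 T) := by simpa [uIcc_of_le hT] using hx.absCont.continuousOn
  refine ⟨⟨(Icc 0 T).domRestrict x, continuousOn_iff_continuous_domRestrict.1 hc⟩, fun t => rfl, ?_⟩
  set ξ : C(Icc (0 : ℝ) T, EuclideanSpace ℝ (Fin n)) :=
    ⟨(Icc 0 T).domRestrict x, continuousOn_iff_continuous_domRestrict.1 hc⟩ with hξ
  have hg := (memLp_top_statePath hT (Lp.memLp u) ξ).comp_continuous_top hf
  ext1 t
  refine (hx.absCont.eq_add_integral hT hg.integrableOn_Icc (ae_le_lpNorm_exponent_top hg) ?_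
    t.2).trans ?_
  · filter_upwards [hx.ode, ae_restrict_mem measurableSet_Icc] with s hs hsT
    rw [statePath, IccExtend_of_mem _ _ hsT]
    exact hs
  · rw [hx.initial]
    rfl

/-- A solution of the integral equation with values in `V` is a trajectory. -/
theorem isTrajectory_of_eq_add_superpositionIntegral (hT : 0 ≤ T)
    (hf : Continuous fun z : EuclideanSpace ℝ (Fin n) × EuclideanSpace ℝ (Fin m) => f z.1 z.2)
    {ξ : C(Icc (0 : ℝ) T, EuclideanSpace ℝ (Fin n))} (hV : ∀ t, ξ t ∈ V)
    (hξ : ξ = ContinuousMap.const _ x₀ + superpositionIntegral hT hf (u, ξ)) :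
    IsTrajectory V f x₀ T u
      (fun t => x₀ + ∫ s in (0 : ℝ)..t, f (statePath hT u ξ s).1 (statePath hT u ξ s).2) := by
  have hg := (memLp_top_statePath hT (Lp.memLp u) ξ).comp_continuous_top hf
  have h0 : (0 : ℝ) ∈ Icc 0 T := left_mem_Icc.2 hT
  have hval : ∀ t (ht : t ∈ Icc 0 T), ξ ⟨t, ht⟩ =
      x₀ + ∫ s in (0 : ℝ)..t, f (statePath hT u ξ s).1 (statePath hT u ξ s).2 := fun t ht =>
    congrArg (fun ζ : C(Icc (0 : ℝ) T, EuclideanSpace ℝ (Fin n)) => ζ ⟨t, ht⟩) hξ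
  refine ⟨absolutelyContinuousOnInterval_add_integral hT hg.integrableOn_Icc
    (ae_le_lpNorm_exponent_top hg) h0 x₀, fun t ht => ?_, by simp, ?_⟩
  · rw [← hval t ht]
    exact hV _
  · filter_upwards [ae_hasDerivAt_add_integral hT hg.integrableOn_Icc h0 x₀,
      ae_restrict_mem measurableSet_Icc] with t ht htT
    rw [← hval t htT]
    rw [statePath, IccExtend_of_mem _ _ htT] at ht
    exact ht

/-- The trajectory picked by choice in `inputOutputMap` also solves the integral equation, so
uniqueness identifies it with `ξ` on [0,T]. -/
theorem inputOutputMap_eq_of_eq_add_superpositionIntegral (hT : 0 ≤ T)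
    (hf : ContDiff ℝ 1
      fun z : EuclideanSpace ℝ (Fin n) × EuclideanSpace ℝ (Fin m) => f z.1 z.2)
    {ξ : C(Icc (0 : ℝ) T, EuclideanSpace ℝ (Fin n))} (hV : ∀ t, ξ t ∈ V)
    (hξ : ξ = ContinuousMap.const _ x₀ + superpositionIntegral hT hf.continuous (u, ξ)) :
    inputOutputMap V f x₀ T u = ξ ⟨T, right_mem_Icc.2 hT⟩ := by
  have h : ∃ x, IsTrajectory V f x₀ T u x :=
    ⟨_, isTrajectory_of_eq_add_superpositionIntegral hT hf.continuous hV hξ⟩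
  obtain ⟨η, hη, hη'⟩ := h.choose_spec.exists_eq_add_superpositionIntegral hT hf.continuous
  rw [inputOutputMap, dif_pos h, eq_of_eq_add_superpositionIntegral hT hf hξ hη', hη]

/-- The input-output map is differentiable at a control whose trajectory is defined on `[0, T]`,
and its differential is given by the linearized system. -/
theorem hasFDerivAt_inputOutputMap (hVo : IsOpen V) (hT : 0 ≤ T)
    (hf : ContDiff ℝ 1
      fun z : EuclideanSpace ℝ (Fin n) × EuclideanSpace ℝ (Fin m) => f z.1 z.2)
    {ξ : C(Icc (0 : ℝ) T, EuclideanSpace ℝ (Fin n))} (hV : ∀ t, ξ t ∈ V)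
    (hξ : ξ = ContinuousMap.const _ x₀ + superpositionIntegral hT hf.continuous (u, ξ)) :
    ∃ L : Control m T →L[ℝ] EuclideanSpace ℝ (Fin n),
      HasFDerivAt (inputOutputMap V f x₀ T) L u ∧
      ∀ v, ∃ ζ : C(Icc (0 : ℝ) T, EuclideanSpace ℝ (Fin n)),
        L v = ζ ⟨T, right_mem_Icc.2 hT⟩ ∧
        ζ = volterraOp hT _ (memLp_top_fderiv_inl_statePath hT (Lp.memLp u) ξ hf) ζ +
          integralOp hT _ (memLp_top_fderiv_inr_statePath hT (Lp.memLp u) ξ hf) v := by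
  set K := volterraOp hT _ (memLp_top_fderiv_inl_statePath hT (Lp.memLp u) ξ hf)
  set J := integralOp hT _ (memLp_top_fderiv_inr_statePath hT (Lp.memLp u) ξ hf)
  let Φ : Control m T × C(Icc (0 : ℝ) T, EuclideanSpace ℝ (Fin n)) →
      C(Icc (0 : ℝ) T, EuclideanSpace ℝ (Fin n)) := fun q =>
    q.2 - (ContinuousMap.const _ x₀ + superpositionIntegral hT hf.continuous q)
  have hΦ : HasStrictFDerivAt Φ (.snd ℝ _ _ - (J ∘L .fst ℝ _ _ + K ∘L .snd ℝ _ _)) (u, ξ) :=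
    hasStrictFDerivAt_snd.sub
      ((hasStrictFDerivAt_superpositionIntegral hT hf (u, ξ)).const_add (ContinuousMap.const _ x₀))
  have hinr : (.snd ℝ _ _ - (J ∘L .fst ℝ _ _ + K ∘L .snd ℝ _ _) :
      Control m T × C(Icc (0 : ℝ) T, EuclideanSpace ℝ (Fin n)) →L[ℝ] _) ∘L .inr ℝ _ _ =
      1 - K := by
    ext1 ζ
    simp
  have hinl : (.snd ℝ _ _ - (J ∘L .fst ℝ _ _ + K ∘L .snd ℝ _ _) :
      Control m T × C(Icc (0 : ℝ) T, EuclideanSpace ℝ (Fin n)) →L[ℝ] _) ∘L .inl ℝ _ _ =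
      -J := by
    ext1 v
    simp
  obtain ⟨k, hk⟩ := isUnit_one_sub_volterraOp hT
    (memLp_top_fderiv_inl_statePath hT (Lp.memLp u) ξ hf)
  have hinv : (1 - K).IsInvertible := ⟨ContinuousLinearEquiv.unitsEquiv ℝ _ k, by
    rw [← hk]; rfl⟩
  have hinv' := hinv
  rw [← hinr] at hinv'
  have hΦ0 : Φ (u, ξ) = 0 := sub_eq_zero.2 hξ
  have hψ := (hΦ.hasStrictFDerivAt_implicitFunctionOfProdDomain hinv').hasFDerivAt
  have hψt := hΦ.tendsto_implicitFunctionOfProdDomain hinv'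
  have hψe := hΦ.eventually_apply_implicitFunctionOfProdDomain hinv'
  set ψ := hΦ.implicitFunctionOfProdDomain hinv'
  rw [hinr, hinl] at hψ
  -- Curves uniformly close to `ξ` stay in the open set `V`, so for controls near `u` the implicit
  -- solution is a genuine trajectory, not just a solution of the integral equation.
  have hVn : ∀ᶠ η : C(Icc (0 : ℝ) T, EuclideanSpace ℝ (Fin n)) in nhds ξ, MapsTo η univ V :=
    (ContinuousMap.isOpen_setOfPred_mapsTo isCompact_univ hVo).mem_nhds fun t _ => hV t
  let ev : C(Icc (0 : ℝ) T, EuclideanSpace ℝ (Fin n)) →L[ℝ] EuclideanSpace ℝ (Fin n) :=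
    ContinuousMap.evalCLM ℝ ⟨T, right_mem_Icc.2 hT⟩
  -- The implicit derivative is -(∂Φ/∂ξ)⁻¹ ∘ ∂Φ/∂v with ∂Φ/∂ξ = 1 - K and ∂Φ/∂v = -J; the signs
  -- cancel to (1 - K)⁻¹ J.
  refine ⟨ev ∘L (-(1 - K).inverse ∘L (-J)), ?_, fun v => ⟨(1 - K).inverse (J v), ?_, ?_⟩⟩
  · refine (ev.hasFDerivAt.comp u hψ).congr_of_eventuallyEq ?_
    filter_upwards [hψe, hψt.eventually hVn] with v h₁ h₂
    exact inputOutputMap_eq_of_eq_add_superpositionIntegral hT hf (fun t => h₂ (mem_univ t))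
      (sub_eq_zero.1 (h₁.trans hΦ0))
  · simp [ev]
  · have : (1 - K) ((1 - K).inverse (J v)) = J v := hinv.self_apply_inverse (J v)
    exact sub_eq_iff_eq_add'.1 this

end Trajectory

/-! ### The adjoint equation and its duality with the linearized system -/

section Adjoint

variable {E F : Type*} [NormedAddCommGroup E] [NormedAddCommGroup F] {T : ℝ}

theorem measurePreserving_sub_left_restrict_Icc (T : ℝ) :
    MeasurePreserving (fun s => T - s) (volume.restrict (Icc 0 T)) (volume.restrict (Icc 0 T)) := by
  have := (volume.measurePreserving_sub_left T).restrict_preimage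
    (measurableSet_Icc (a := 0) (b := T))
  simpa using this

/-- Solvability of a linear differential equation with prescribed final value. -/
theorem exists_eq_add_integral_backward [NormedSpace ℝ E] [CompleteSpace E] (hT : 0 ≤ T)
    {A : ℝ → E →L[ℝ] E} (hA : MemLp A ∞ (volume.restrict (Icc 0 T))) (ψ : E) :
    ∃ p : C(Icc (0 : ℝ) T, E), ∀ t : Icc (0 : ℝ) T,
      p t = ψ + ∫ s in T..t, A s (IccExtend hT p s) := by
  -- Time reversal: q(s) = p(T - s) solves an initial value problem with kernel -A(T - s), to which
  -- the inverse of 1 - K applies.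
  have hA' : MemLp (fun s => -A (T - s)) ∞ (volume.restrict (Icc 0 T)) :=
    (hA.comp_measurePreserving (measurePreserving_sub_left_restrict_Icc T)).neg
  obtain ⟨k, hk⟩ := isUnit_one_sub_volterraOp hT hA'
  set q := (↑k⁻¹ : C(Icc (0 : ℝ) T, E) →L[ℝ] C(Icc (0 : ℝ) T, E)) (ContinuousMap.const _ ψ)
  have hq : q = ContinuousMap.const _ ψ + volterraOp hT _ hA' q := by
    have : (1 - volterraOp hT _ hA') q = ContinuousMap.const _ ψ := by
      rw [← hk]
      exact congrArg (fun L : C(Icc (0 : ℝ) T, E) →L[ℝ] C(Icc (0 : ℝ) T, E) =>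
        L (ContinuousMap.const _ ψ)) k.mul_inv
    exact sub_eq_iff_eq_add.1 this
  have hr : ∀ t : Icc (0 : ℝ) T, T - t ∈ Icc 0 T := fun t =>
    ⟨sub_nonneg.2 t.2.2, sub_le_self _ t.2.1⟩
  let p : C(Icc (0 : ℝ) T, E) := ⟨fun t => q ⟨T - t, hr t⟩, by fun_prop⟩
  have hp : ∀ s ∈ Icc 0 T, IccExtend hT q s = IccExtend hT p (T - s) := fun s hs => by
    rw [IccExtend_of_mem _ _ hs, IccExtend_of_mem _ _ (hr ⟨s, hs⟩)]
    simp [p]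
  refine ⟨p, fun t => ?_⟩
  have h₁ : p t = ψ + ∫ s in (0 : ℝ)..(T - t), (-A (T - s)) (IccExtend hT q s) :=
    congrArg (fun ζ : C(Icc (0 : ℝ) T, E) => ζ ⟨T - t, hr t⟩) hq
  have h₂ : ∫ s in (0 : ℝ)..(T - t), (-A (T - s)) (IccExtend hT q s) =
      ∫ s in (0 : ℝ)..(T - t), -(A (T - s) (IccExtend hT p (T - s))) := by
    refine intervalIntegral.integral_congr fun s hs => ?_
    rw [uIcc_of_le (hr t).1] at hs
    rw [hp s ⟨hs.1, hs.2.trans (hr t).2⟩]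
    rfl
  rw [h₁, h₂, intervalIntegral.integral_neg,
    intervalIntegral.integral_comp_sub_left (fun s => A s (IccExtend hT p s)) T,
    ← intervalIntegral.integral_symm, sub_zero, sub_sub_cancel]

/-- A solution of a linear differential equation with nonzero final value never vanishes. -/
theorem ne_zero_of_eq_add_integral_backward [NormedSpace ℝ E] (hT : 0 ≤ T)
    {A : ℝ → E →L[ℝ] E} (hA : MemLp A ∞ (volume.restrict (Icc 0 T))) {ψ : E} (hψ : ψ ≠ 0)
    {p : C(Icc (0 : ℝ) T, E)}
    (hp : ∀ t : Icc (0 : ℝ) T, p t = ψ + ∫ s in T..t, A s (IccExtend hT p s))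
    (t₀ : Icc (0 : ℝ) T) : p t₀ ≠ 0 := by
  intro h₀
  have hT' : T ∈ Icc 0 T := right_mem_Icc.2 hT
  have hi := (hA.clm_apply_top (memLp_top_IccExtend hT p)).integrableOn_Icc
  have hc : Continuous fun s => ‖IccExtend hT p s‖ := (continuous_IccExtend_coe hT p).norm
  have hb : ∀ᵐ s ∂(volume.restrict (Icc 0 T)), ‖A s (IccExtend hT p s)‖ ≤
      lpNorm A ∞ (volume.restrict (Icc 0 T)) * ‖IccExtend hT p s‖ := by
    filter_upwards [ae_le_lpNorm_exponent_top hA] with s hs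
    exact (A s).le_of_opNorm_le hs _
  -- From p(t₀) = 0, Grönwall on [t₀, T] gives p(T) = 0, whereas p(T) = ψ.
  have hz := eq_zero_of_le_mul_integral (a := t₀) (b := T)
    (C := lpNorm A ∞ (volume.restrict (Icc 0 T))) hc.continuousOn (fun t _ => norm_nonneg _)
    (fun t ht => by
      have htT : t ∈ Icc 0 T := ⟨t₀.2.1.trans ht.1, ht.2⟩
      have : p ⟨t, htT⟩ = ∫ s in (t₀ : ℝ)..t, A s (IccExtend hT p s) := by
        rw [← sub_zero (p ⟨t, htT⟩), ← h₀, hp, hp t₀, add_sub_add_left_eq_sub]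
        exact intervalIntegral.integral_interval_sub_left
          (intervalIntegrable_of_integrableOn_Icc hi hT' htT)
          (intervalIntegrable_of_integrableOn_Icc hi hT' t₀.2)
      rw [IccExtend_of_mem _ _ htT, this, ← intervalIntegral.integral_const_mul]
      refine intervalIntegral.norm_integral_le_of_norm_le ht.1 ?_
        ((continuous_const.mul hc).intervalIntegrable _ _)
      have := ae_mem_uIoc_of_ae_restrict_Icc hb t₀.2 htT
      rwa [uIoc_of_le ht.1] at this) T (right_mem_Icc.2 t₀.2.2)
  rw [IccExtend_of_mem _ _ hT', norm_eq_zero, hp] at hz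
  simp [hψ] at hz

/-- Product rule for Lipschitz constants, both factors being bounded on the compact set. It makes
⟨p, ζ⟩ absolutely continuous, so that this function can be recovered from its derivative. -/
theorem LipschitzOnWith.exists_inner {X : Type*} [PseudoMetricSpace X] [InnerProductSpace ℝ E]
    {P Z : X → E} {s : Set X} {K L : NNReal} (hP : LipschitzOnWith K P s)
    (hZ : LipschitzOnWith L Z s) (hs : IsCompact s) :
    ∃ C, LipschitzOnWith C (fun t => inner ℝ (P t) (Z t)) s := by
  obtain ⟨M, hM⟩ := hs.exists_bound_of_continuousOn hP.continuousOn
  obtain ⟨N, hN⟩ := hs.exists_bound_of_continuousOn hZ.continuousOn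
  refine ⟨(K * N + M * L).toNNReal, LipschitzOnWith.of_dist_le_mul fun x hx y hy => ?_⟩
  refine le_trans ?_ (mul_le_mul_of_nonneg_right (Real.le_coe_toNNReal _) dist_nonneg)
  have h₁ := hP.dist_le_mul x hx y hy
  have h₂ := hZ.dist_le_mul x hx y hy
  rw [dist_eq_norm] at h₁ h₂
  have : (inner ℝ (P x) (Z x) - inner ℝ (P y) (Z y) : ℝ) =
      inner ℝ (P x - P y) (Z x) + inner ℝ (P y) (Z x - Z y) := by
    rw [inner_sub_left, inner_sub_right]; ring
  rw [dist_eq_norm, this]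
  calc _ ≤ ‖P x - P y‖ * ‖Z x‖ + ‖P y‖ * ‖Z x - Z y‖ :=
        (norm_add_le _ _).trans (add_le_add (norm_inner_le_norm _ _) (norm_inner_le_norm _ _))
    _ ≤ (K * dist x y) * N + M * (L * dist x y) := by
        gcongr
        · exact hN x hx
        · exact (norm_nonneg _).trans (hM y hy)
        · exact hM y hy
    _ = _ := by ring

theorem MeasureTheory.MemLp.adjoint {α : Type*} [MeasurableSpace α] {μ : Measure α}
    [InnerProductSpace ℝ E] [InnerProductSpace ℝ F] [CompleteSpace E] [CompleteSpace F]
    {r : ℝ≥0∞} {A : α → E →L[ℝ] F} (hA : MemLp A r μ) :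
    MemLp (fun s => ContinuousLinearMap.adjoint (A s)) r μ :=
  hA.of_le (ContinuousLinearMap.adjoint.continuous.comp_aestronglyMeasurable
    hA.aestronglyMeasurable)
    (Filter.Eventually.of_forall fun s => (ContinuousLinearMap.adjoint.norm_map (A s)).le)

/-- Duality between the linearized system and the adjoint equation. -/
theorem inner_eq_integral_inner_of_adjoint [InnerProductSpace ℝ E] [CompleteSpace E] (hT : 0 ≤ T)
    {A : ℝ → E →L[ℝ] E} (hA : MemLp A ∞ (volume.restrict (Icc 0 T))) {b : ℝ → E}
    (hb : MemLp b ∞ (volume.restrict (Icc 0 T))) {ψ : E} {p ζ : C(Icc (0 : ℝ) T, E)}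
    (hp : ∀ t : Icc (0 : ℝ) T,
      p t = ψ + ∫ s in T..t, (-ContinuousLinearMap.adjoint (A s)) (IccExtend hT p s))
    (hζ : ∀ t : Icc (0 : ℝ) T, ζ t = ∫ s in (0 : ℝ)..t, (A s (IccExtend hT ζ s) + b s)) :
    inner ℝ ψ (ζ ⟨T, right_mem_Icc.2 hT⟩) =
      ∫ s in (0 : ℝ)..T, inner ℝ (IccExtend hT p s) (b s) := by
  have h0 : (0 : ℝ) ∈ Icc 0 T := left_mem_Icc.2 hT
  have hT' : T ∈ Icc 0 T := right_mem_Icc.2 hT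
  have hip : MemLp (fun s => (-ContinuousLinearMap.adjoint (A s)) (IccExtend hT p s)) ∞
      (volume.restrict (Icc 0 T)) := hA.adjoint.neg.clm_apply_top (memLp_top_IccExtend hT p)
  have hiζ : MemLp (fun s => A s (IccExtend hT ζ s) + b s) ∞ (volume.restrict (Icc 0 T)) :=
    (hA.clm_apply_top (memLp_top_IccExtend hT ζ)).add hb
  have hlp := lipschitzOnWith_add_integral (C := Real.toNNReal _) hip.integrableOn_Icc
    ((ae_le_lpNorm_exponent_top hip).mono fun s hs => hs.trans (Real.le_coe_toNNReal _)) hT' ψ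
  have hlζ := lipschitzOnWith_add_integral (C := Real.toNNReal _) hiζ.integrableOn_Icc
    ((ae_le_lpNorm_exponent_top hiζ).mono fun s hs => hs.trans (Real.le_coe_toNNReal _)) h0 0
  obtain ⟨C, hC⟩ := hlp.exists_inner hlζ isCompact_Icc
  have hpb : MemLp (fun s => inner ℝ (IccExtend hT p s) (b s)) ∞ (volume.restrict (Icc 0 T)) := by
    refine memLp_top_of_bound
      ((continuous_IccExtend_coe hT p).aestronglyMeasurable.inner hb.aestronglyMeasurable)
      (‖p‖ * lpNorm b ∞ (volume.restrict (Icc 0 T))) ?_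
    filter_upwards [ae_le_lpNorm_exponent_top hb] with s hs
    exact (norm_inner_le_norm _ _).trans
      (mul_le_mul (norm_IccExtend_le hT p s) hs (norm_nonneg _) (norm_nonneg _))
  -- In ⟨p, ζ⟩' the terms ⟨p, Aζ⟩ and -⟨Aᵀp, ζ⟩ cancel, leaving ⟨p, b⟩; the initial term vanishes
  -- because ζ(0) = 0.
  have := (hC.mono (uIcc_of_le hT).le).absolutelyContinuousOnInterval.eq_add_integral hT
    hpb.integrableOn_Icc
    (ae_le_lpNorm_exponent_top hpb) (by
      filter_upwards [ae_hasDerivAt_add_integral hT hip.integrableOn_Icc hT' ψ,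
        ae_hasDerivAt_add_integral hT hiζ.integrableOn_Icc h0 0,
        ae_restrict_mem measurableSet_Icc] with t h₁ h₂ ht
      have := h₁.inner ℝ h₂
      rw [← hp ⟨t, ht⟩, zero_add, ← hζ ⟨t, ht⟩, IccExtend_of_mem _ _ ht,
        IccExtend_of_mem _ _ ht] at this
      rw [IccExtend_of_mem _ _ ht]
      refine this.congr_deriv ?_
      rw [neg_apply, inner_neg_left, ContinuousLinearMap.adjoint_inner_left,
        inner_add_right]
      ring) hT'
  simpa [← hζ ⟨T, hT'⟩] using this

/-- A covector annihilating all the final values of the linearized system gives rise to a solution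
of the adjoint equation annihilating the input operator. -/
theorem ae_adjoint_apply_eq_zero [InnerProductSpace ℝ E] [CompleteSpace E]
    [InnerProductSpace ℝ F] [CompleteSpace F] (hT : 0 ≤ T)
    {A : ℝ → E →L[ℝ] E} (hA : MemLp A ∞ (volume.restrict (Icc 0 T)))
    {B : ℝ → F →L[ℝ] E} (hB : MemLp B ∞ (volume.restrict (Icc 0 T))) {ψ : E}
    {p : C(Icc (0 : ℝ) T, E)}
    (hp : ∀ t : Icc (0 : ℝ) T,
      p t = ψ + ∫ s in T..t, (-ContinuousLinearMap.adjoint (A s)) (IccExtend hT p s))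
    (h : ∀ v, ∃ ζ : C(Icc (0 : ℝ) T, E), inner ℝ ψ (ζ ⟨T, right_mem_Icc.2 hT⟩) = 0 ∧
      ζ = volterraOp hT A hA ζ + integralOp hT B hB v) :
    ∀ᵐ s ∂(volume.restrict (Icc 0 T)),
      ContinuousLinearMap.adjoint (B s) (IccExtend hT p s) = 0 := by
  -- The test control is v = Bᵀp, admissible because it is essentially bounded; the duality formula
  -- then reads 0 = ∫ ‖Bᵀp‖².
  have hv := hB.adjoint.clm_apply_top (memLp_top_IccExtend hT p)
  obtain ⟨ζ, hζ₀, hζ⟩ := h (hv.toLp _)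
  have hb := hB.clm_apply_top hv
  have h0 : (0 : ℝ) ∈ Icc 0 T := left_mem_Icc.2 hT
  have hAζ := hA.clm_apply_top (memLp_top_IccExtend hT ζ)
  have key := inner_eq_integral_inner_of_adjoint hT hA hb hp (ζ := ζ) (fun t => by
    rw [intervalIntegral.integral_add
      (intervalIntegrable_of_integrableOn_Icc hAζ.integrableOn_Icc h0 t.2)
      (intervalIntegrable_of_integrableOn_Icc hb.integrableOn_Icc h0 t.2)]
    refine (congrArg (fun η : C(Icc (0 : ℝ) T, E) => η t) hζ).trans ?_
    refine congrArg₂ (fun a b : E => a + b) rfl (intervalIntegral.integral_congr_ae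
      (ae_mem_uIoc_of_ae_restrict_Icc ?_ h0 t.2))
    filter_upwards [hv.coeFn_toLp] with s hs
    rw [hs])
  rw [hζ₀] at key
  have hsq (s : ℝ) : inner ℝ (IccExtend hT p s)
      (B s (ContinuousLinearMap.adjoint (B s) (IccExtend hT p s))) =
      ‖ContinuousLinearMap.adjoint (B s) (IccExtend hT p s)‖ ^ 2 := by
    rw [← ContinuousLinearMap.adjoint_inner_left, real_inner_self_eq_norm_sq]
  simp_rw [hsq] at key
  rw [intervalIntegral.integral_of_le hT, ← integral_Icc_eq_integral_Ioc, eq_comm,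
    integral_eq_zero_iff_of_nonneg (fun s => sq_nonneg _)] at key
  · filter_upwards [key] with s hs
    simpa using hs
  · have hvv : MemLp (fun s => ‖ContinuousLinearMap.adjoint (B s) (IccExtend hT p s)‖ ^ 2) ∞
        (volume.restrict (Icc 0 T)) := by
      refine memLp_top_of_bound (C := lpNorm (fun s => ContinuousLinearMap.adjoint (B s)
        (IccExtend hT p s)) ∞ (volume.restrict (Icc 0 T)) ^ 2)
        (hv.aestronglyMeasurable.norm.pow 2) ?_
      filter_upwards [ae_le_lpNorm_exponent_top hv] with s hs
      rw [norm_pow, norm_norm]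
      exact pow_le_pow_left₀ (norm_nonneg _) hs 2
    exact hvv.integrable le_top

end Adjoint

/-! ### Gradients of the Hamiltonian -/

section Gradient

variable {E U : Type*} [NormedAddCommGroup E] [InnerProductSpace ℝ E] [CompleteSpace E]
  [NormedAddCommGroup U] [InnerProductSpace ℝ U] [CompleteSpace U]

theorem gradient_inner_left (c q : E) : gradient (fun q => inner ℝ q c) q = c := by
  refine HasGradientAt.gradient (hasGradientAt_iff_hasFDerivAt.2 ?_)
  refine (InnerProductSpace.toDual ℝ E c).hasFDerivAt.congr_of_eventuallyEq
    (Filter.Eventually.of_forall fun y => ?_)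
  rw [InnerProductSpace.toDual_apply_apply, real_inner_comm]

theorem gradient_inner_comp {h : U → E} {h' : U →L[ℝ] E} {w : U} (hh : HasFDerivAt h h' w) (p : E) :
    gradient (fun w => inner ℝ p (h w)) w = ContinuousLinearMap.adjoint h' p := by
  refine HasGradientAt.gradient (hasGradientAt_iff_hasFDerivAt.2 ?_)
  have : InnerProductSpace.toDual ℝ U (ContinuousLinearMap.adjoint h' p) = (innerSL ℝ p) ∘L h' := by
    ext y
    simp [ContinuousLinearMap.adjoint_inner_left]
  rw [this]
  exact (innerSL ℝ p).hasFDerivAt.comp w hh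

end Gradient

/-! ### The Hamiltonian characterization of singular controls -/

theorem mainTheorem1 {n m : ℕ} (V : Set (EuclideanSpace ℝ (Fin n))) (hV : IsOpen V)
    (f : EuclideanSpace ℝ (Fin n) → EuclideanSpace ℝ (Fin m) → EuclideanSpace ℝ (Fin n))
    (hf : ContDiff ℝ ∞
      (fun z : EuclideanSpace ℝ (Fin n) × EuclideanSpace ℝ (Fin m) => f z.1 z.2))
    (x₀ : EuclideanSpace ℝ (Fin n)) (T : ℝ) (hT : 0 < T) (u : Control m T)
    (hu : IsSingularControl V f x₀ T u)
    (x : ℝ → EuclideanSpace ℝ (Fin n)) (hx : IsTrajectory V f x₀ T u x) :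
    ∃ p : ℝ → EuclideanSpace ℝ (Fin n),
      ContinuousOn p (Icc 0 T) ∧ AbsolutelyContinuousOnInterval p 0 T ∧
      (∀ t ∈ Icc (0 : ℝ) T, p t ≠ 0) ∧
      ∀ᵐ t ∂(volume.restrict (Icc (0 : ℝ) T)),
        HasDerivAt x (gradient (fun q => hamiltonian f (x t) q (u t)) (p t)) t ∧
        HasDerivAt p (-gradient (fun y => hamiltonian f y (p t) (u t)) (x t)) t ∧
        gradient (fun w => hamiltonian f (x t) (p t) w) (u t) = 0 := by
  have hf1 : ContDiff ℝ 1
      (fun z : EuclideanSpace ℝ (Fin n) × EuclideanSpace ℝ (Fin m) => f z.1 z.2) :=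
    hf.of_le (by exact_mod_cast le_top)
  have hT0 := hT.le
  have hTm : T ∈ Icc 0 T := right_mem_Icc.2 hT0
  obtain ⟨ξ, hξx, hξ⟩ := hx.exists_eq_add_superpositionIntegral hT0 hf1.continuous
  obtain ⟨L, hL, hLζ⟩ := hasFDerivAt_inputOutputMap hV hT0 hf1
    (fun t => by rw [hξx]; exact hx.mem t t.2) hξ
  have hA := memLp_top_fderiv_inl_statePath hT0 (Lp.memLp u) ξ hf1
  have hB := memLp_top_fderiv_inr_statePath hT0 (Lp.memLp u) ξ hf1
  have hns := hu.2
  -- Differentiability is essential here: `fderiv` would otherwise be the default value 0, and its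
  -- failure to be surjective would say nothing about the linearized system.
  rw [hL.fderiv] at hns
  have hrange : (LinearMap.range L.toLinearMap)ᗮ ≠ ⊥ := fun h =>
    hns (LinearMap.range_eq_top.1 (Submodule.orthogonal_eq_bot_iff.1 h))
  obtain ⟨ψ, hψ, hψ0⟩ := Submodule.exists_mem_ne_zero_of_ne_bot hrange
  obtain ⟨p, hp⟩ := exists_eq_add_integral_backward hT0 hA.adjoint.neg ψ
  have hip := hA.adjoint.neg.clm_apply_top (memLp_top_IccExtend hT0 p)
  have hBp := ae_adjoint_apply_eq_zero hT0 hA hB hp (fun v => by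
    obtain ⟨ζ, h₁, h₂⟩ := hLζ v
    refine ⟨ζ, ?_, h₂⟩
    rw [← h₁, real_inner_comm]
    exact hψ _ ⟨v, rfl⟩)
  have hac := absolutelyContinuousOnInterval_add_integral hT0 hip.integrableOn_Icc
    (ae_le_lpNorm_exponent_top hip) hTm ψ
  -- The witness is t ↦ ψ + ∫ from T to t of -Aᵀp, defined on all of ℝ and equal to `p` on [0,T].
  refine ⟨_, by simpa [uIcc_of_le hT0] using hac.continuousOn, hac, fun t ht => ?_, ?_⟩
  · exact (hp ⟨t, ht⟩) ▸ ne_zero_of_eq_add_integral_backward hT0 hA.adjoint.neg hψ0 hp ⟨t, ht⟩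
  filter_upwards [hx.ode, ae_hasDerivAt_add_integral hT0 hip.integrableOn_Icc hTm ψ, hBp,
    ae_restrict_mem measurableSet_Icc] with t h₁ h₂ h₃ ht
  have hpt := hp ⟨t, ht⟩
  have hst : statePath hT0 u ξ t = (x t, u t) := by
    rw [statePath, IccExtend_of_mem _ _ ht, hξx]
  rw [IccExtend_of_mem _ _ ht] at h₃
  rw [hst, hpt] at h₃
  have hg := (hf1.differentiable one_ne_zero (x t, u t)).hasFDerivAt
  have hgx : HasFDerivAt (fun y => f y (u t))
      (fderiv ℝ (fun z : EuclideanSpace ℝ (Fin n) × EuclideanSpace ℝ (Fin m) => f z.1 z.2)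
        (x t, u t) ∘L .inl ℝ _ _) (x t) :=
    HasFDerivAt.comp (f := fun y => (y, u t)) (x t) hg (hasFDerivAt_prodMk_left _ _)
  have hgu : HasFDerivAt (fun w => f (x t) w)
      (fderiv ℝ (fun z : EuclideanSpace ℝ (Fin n) × EuclideanSpace ℝ (Fin m) => f z.1 z.2)
        (x t, u t) ∘L .inr ℝ _ _) (u t) :=
    HasFDerivAt.comp (f := fun w => (x t, w)) (u t) hg (hasFDerivAt_prodMk_right _ _)
  refine ⟨?_, ?_, ?_⟩
  · simp only [hamiltonian]
    rwa [gradient_inner_left]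
  · simp only [hamiltonian]
    rw [gradient_inner_comp hgx]
    refine h₂.congr_deriv ?_
    rw [Pi.neg_apply, IccExtend_of_mem _ _ ht, hpt, hst]
    rfl
  · simp only [hamiltonian]
    rw [gradient_inner_comp hgu]
    exact h₃
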